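/- Let $\mathcal M$ be a finite-dimensional smooth Riemannian manifold without boundary, and let $R:T\mathcal M\to\mathcal M$ be a retraction, i.e. a $C^\infty$ map with $R_x(0_x)=x$ and $\frac{d}{dt}R_x(t\eta)|_{t=0}=\eta$ for all $x\in\mathcal M$, $\eta\in T_x\mathcal M$. Let $F=f+g$, where $f:\mathcal M\to\mathbb R$ is continuously differentiable and $g:\mathcal M\to\mathbb R$ is locally Lipschitz (equivalently, $g\circ R_x$ is locally Lipschitz on $T_x\mathcal M$ for every $x$). For a function $h$ on an inner product space $V$ put $h^\circ(\eta;v)=\limsup_{\xi\to\eta,\,t\downarrow0}\frac{h(\xi+tv)-h(\xi)}{t}$ and let $\partial h(\eta)=\{\zeta\in V:\langle\zeta,v\rangle\le h^\circ(\eta;v)\ \forall v\in V\}$ be the Clarke subdifferential. For $h:\mathcal M\to\mathbb R$ let $\partial h(x)=\partial(h\circ R_x)(0_x)$; a point $x$ is a stationary point of $F$ if $0\in\partial F(x)$. A function $h$ is $L$-retraction-smooth in $\mathcal N\subseteq\mathcal M$ if $h(R_x(\eta))\le h(x)+\langle\operatorname{grad}h(x),\eta\rangle_x+\frac L2\|\eta\|_x^2$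 whenever $x\in\mathcal N$, $\eta\in T_x\mathcal M$ and $R_x(\eta)\in\mathcal N$. Let $\tilde L>0$, let $q:\mathbb R^2\to\mathbb R$ be continuous, let $\varepsilon_k>0$, and let $\{x_k\}$ be generated by the inexact Riemannian proximal gradient method: with $\ell_x(\eta)=\langle\operatorname{grad}f(x),\eta\rangle_x+\frac{\tilde L}2\|\eta\|_x^2+g(R_x(\eta))$, for every $k\ge0$ there are $\hat\eta_k,\eta_k^*\in T_{x_k}\mathcal M$ such that $0\in\partial\ell_{x_k}(\eta_k^*)$, $$\|\hat\eta_k-\eta_k^*\|\le q(\varepsilon_k,\|\hat\eta_k\|),\qquad \ell_{x_k}(\hat\eta_k)\le\ell_{x_k}(0),\qquad x_{k+1}=R_{x_k}(\hat\eta_k).$$ Assume that $F$ is bounded from below, that the sublevel set $\Omega_{x_0}=\{x\in\mathcal M: F(x)\le F(x_0)\}$ is compact, that $f$ is $L$-retraction-smooth in a set $\mathcal N\supseteq\Omega_{x_0}$ that contains all the iterates $x_k$ (for instance $\mathcal N=\mathcal M$, or $\mathcal N=\Omega_{x_0}$ if the iterates stay in $\Omega_{x_0}$), that $\tilde L>L$,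 and that $\lim_{k\to\infty}q(\varepsilon_k,\|\hat\eta_k\|)=0$. Then $\{x_k\}$ has at least one accumulation point. If $x_*$ is any accumulation point of $\{x_k\}$, then $x_*$ is a stationary point of $F$; moreover, with $\beta=(\tilde L-L)/2$, for every $\epsilon>0$ there is an index $k\le (F(x_0)-F(x_*))/(\beta\epsilon^2)$ such that $\|\hat\eta_k\|\le\epsilon$. -/

import Mathlib

open Set Filter Topology
open scoped Manifold ContDiff Bundle

noncomputable section

namespace IRPG

section Clarke

variable {V : Type*} [NormedAddCommGroup V] [InnerProductSpace ℝ V]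

/-- Clarke generalized directional derivative
`h°(η; v) = limsup_{ξ → η, t ↓ 0} (h (ξ + t v) - h ξ) / t`. The upper limit is taken in the extended
reals, so that it always exists; it is a real number when `h` is Lipschitz near `η`. -/
def clarkeDeriv (h : V → ℝ) (η v : V) : EReal :=
  limsup (fun p : V × ℝ => (((h (p.1 + p.2 • v) - h p.1) / p.2 : ℝ) : EReal))
    (𝓝 η ×ˢ 𝓝[>] (0 : ℝ))

/-- Clarke generalized subdifferential of a function on an inner product space. -/
def clarkeSubdiff (h : V → ℝ) (η : V) : Set V :=
  {ζ | ∀ v : V, ((inner ℝ ζ v : ℝ) : EReal) ≤ clarkeDeriv h η v}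

end Clarke

section Manifold

variable (E : Type*) [NormedAddCommGroup E] [NormedSpace ℝ E]
  (M : Type*) [TopologicalSpace M] [ChartedSpace E M] [IsManifold 𝓘(ℝ, E) ∞ M]

/-- A (globally defined) retraction on `M`: a smooth map `R : TM → M` with `R(0_x) = x` and
`d/dt R(t η)|_{t = 0} = η` for all `η ∈ T_x M`. -/
structure Retraction where
  /-- The underlying map on the tangent bundle. -/
  toFun : TangentBundle 𝓘(ℝ, E) M → M
  contMDiff_toFun : ContMDiff 𝓘(ℝ, E).tangent 𝓘(ℝ, E) ∞ toFun
  map_zero : ∀ x : M, toFun ⟨x, 0⟩ = x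
  hasMFDerivAt_ray : ∀ (x : M) (η : TangentSpace 𝓘(ℝ, E) x),
    HasMFDerivAt 𝓘(ℝ, ℝ) 𝓘(ℝ, E) (fun t : ℝ => toFun ⟨x, t • η⟩) 0
      (ContinuousLinearMap.toSpanSingleton ℝ (show E from η))

variable {E M}

/-- The restriction `R_x` of a retraction to `T_x M`. -/
def Retraction.at (R : Retraction E M) (x : M) (η : TangentSpace 𝓘(ℝ, E) x) : M :=
  R.toFun ⟨x, η⟩

variable [FiniteDimensional ℝ E] [Bundle.RiemannianBundle (fun x : M => TangentSpace 𝓘(ℝ, E) x)]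

/-- The Riemannian gradient: the Riesz representative of the differential with respect to the
Riemannian metric. -/
def grad (h : M → ℝ) (x : M) : TangentSpace 𝓘(ℝ, E) x :=
  haveI : FiniteDimensional ℝ (TangentSpace 𝓘(ℝ, E) x) := inferInstanceAs (FiniteDimensional ℝ E)
  haveI : CompleteSpace (TangentSpace 𝓘(ℝ, E) x) := FiniteDimensional.complete ℝ _
  (InnerProductSpace.toDual ℝ (TangentSpace 𝓘(ℝ, E) x)).symm (mfderiv 𝓘(ℝ, E) 𝓘(ℝ, ℝ) h x)

theorem inner_grad (h : M → ℝ) (x : M) (η : TangentSpace 𝓘(ℝ, E) x) :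
    inner ℝ (grad h x) η = mfderiv 𝓘(ℝ, E) 𝓘(ℝ, ℝ) h x η := by
  have : FiniteDimensional ℝ (TangentSpace 𝓘(ℝ, E) x) := inferInstanceAs (FiniteDimensional ℝ E)
  have : CompleteSpace (TangentSpace 𝓘(ℝ, E) x) := FiniteDimensional.complete ℝ _
  exact InnerProductSpace.toDual_symm_apply

/-- `h` is `L`-retraction-smooth with respect to `R` in `N`. -/
def RetractionSmoothOn (R : Retraction E M) (L : ℝ) (h : M → ℝ) (N : Set M) : Prop :=
  ∀ x ∈ N, ∀ S : Set (TangentSpace 𝓘(ℝ, E) x), MapsTo (R.at x) S N →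
    ∀ η ∈ S, h (R.at x η) ≤ h x + inner ℝ (grad h x) η + L / 2 * ‖η‖ ^ 2

/-- `h` is locally Lipschitz: every pullback `h ∘ R_x` is locally Lipschitz on `T_x M`.
As `R_x` is smooth and a diffeomorphism near `0_x`, this is local Lipschitz continuity on `M`. -/
def RetractionLocallyLipschitz (R : Retraction E M) (h : M → ℝ) : Prop :=
  ∀ x : M, LocallyLipschitz (fun η : TangentSpace 𝓘(ℝ, E) x => h (R.at x η))

/-- The Riemannian generalized subdifferential `∂h(x) = ∂(h ∘ R_x)(0_x)`. -/
def riemannianSubdiff (R : Retraction E M) (h : M → ℝ) (x : M) : Set (TangentSpace 𝓘(ℝ, E) x) :=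
  clarkeSubdiff (fun η : TangentSpace 𝓘(ℝ, E) x => h (R.at x η)) 0

/-- `x` is a stationary point of `h`: `0 ∈ ∂h(x)`. -/
def IsStationaryPoint (R : Retraction E M) (h : M → ℝ) (x : M) : Prop :=
  (0 : TangentSpace 𝓘(ℝ, E) x) ∈ riemannianSubdiff R h x

/-- The objective
`ℓ_x(η) = ⟨grad f(x), η⟩ + (Lt / 2) ‖η‖² + g(R_x(η))` of the Riemannian proximal mapping. -/
def proxModel (R : Retraction E M) (f g : M → ℝ) (Lt : ℝ) (x : M)
    (η : TangentSpace 𝓘(ℝ, E) x) : ℝ :=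
  inner ℝ (grad f x) η + Lt / 2 * ‖η‖ ^ 2 + g (R.at x η)

/-- `x 0, x 1, …` are the iterates of a run of the inexact Riemannian proximal gradient method for
`f + g`, with parameter `Lt`, tolerances `ε k`, accuracy function `q`, search directions `ηhat k`,
and `ηstar k` the stationary point of the proximal objective at `x k` that `ηhat k` approximates. -/
structure IsIRPGRun (R : Retraction E M) (f g : M → ℝ) (Lt : ℝ) (q : ℝ × ℝ → ℝ) (ε : ℕ → ℝ)
    (x : ℕ → M) (ηhat ηstar : ∀ k, TangentSpace 𝓘(ℝ, E) (x k)) : Prop where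
  Lt_pos : 0 < Lt
  continuous_q : Continuous q
  ε_pos : ∀ k, 0 < ε k
  stationary : ∀ k, 0 ∈ clarkeSubdiff (proxModel R f g Lt (x k)) (ηstar k)
  accuracy : ∀ k, ‖ηhat k - ηstar k‖ ≤ q (ε k, ‖ηhat k‖)
  descent : ∀ k, proxModel R f g Lt (x k) (ηhat k) ≤ proxModel R f g Lt (x k) 0
  update : ∀ k, x (k + 1) = R.at (x k) (ηhat k)

end Manifold

end IRPG

end

/-! Adding retraction-smoothness of `f` along the step to the descent condition on the model cancels
the gradient term and leaves `F (x (k+1)) + β ‖ηhat k‖² ≤ F (x k)`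
(`IsIRPGRun.sufficient_decrease`). Hence the iterates stay in the compact sublevel set, `ηhat k →
0`, and by the accuracy condition `ηstar k → 0`. Telescoping gives the index bound, since `F` at an
accumulation point is below every `F (x k)`.

The substance is stationarity of the limit: `0 ∈ ∂ℓ_{x k}(ηstar k)` involves the maps `R_{x k}`, all
different, while the conclusion involves `R_{xs}` at `0`. In a chart at `xs` and a trivialization of
the tangent bundle, `R` becomes one smooth map `Ψ (p, u)` whose `u`-derivative at the base point is
the identity. Strict differentiability shows that moving `u` by `t v` moves `Ψ (p, u)` by `t v +
o(t)`, uniformly in `p` and `u` nearby. A Lipschitz `g` therefore has the same difference quotients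
along all these maps up to small errors (`frequently_of_frequently_family`), and Clarke stationarity
passes to the limit (`isStationaryPoint_of_mapClusterPt`). -/

namespace IRPG

/-! ### Clarke stationarity without upper limits -/

section VectorSpace

variable {V : Type*} [NormedAddCommGroup V] [InnerProductSpace ℝ V]

/-- The condition `0 ≤ h°(η; v)` in terms of difference quotients. -/
theorem zero_le_clarkeDeriv_iff {h : V → ℝ} {η v : V} :
    0 ≤ clarkeDeriv h η v ↔ ∀ r : ℝ, 0 < r →
      ∃ᶠ p : V × ℝ in 𝓝 η ×ˢ 𝓝[>] (0 : ℝ), -(r * p.2) ≤ h (p.1 + p.2 • v) - h p.1 := by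
  have hpos : ∀ᶠ p : V × ℝ in 𝓝 η ×ˢ 𝓝[>] (0 : ℝ), 0 < p.2 :=
    tendsto_snd.eventually self_mem_nhdsWithin
  unfold clarkeDeriv
  rw [le_limsup_iff']
  constructor
  · intro H r hr
    have h1 := H ((-r : ℝ) : EReal) (by exact_mod_cast neg_neg_of_pos hr)
    refine (h1.and_eventually hpos).mono ?_
    rintro p ⟨hp, h0⟩
    rw [EReal.coe_le_coe_iff, le_div_iff₀ h0] at hp
    linarith
  · intro H y hy
    -- `y` may be `⊥`, so a real number between `y` and `0` supplies the tolerance.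
    obtain ⟨z, hyz, hz⟩ := EReal.lt_iff_exists_real_btwn.1 hy
    have hz' : z < 0 := by exact_mod_cast hz
    refine ((H (-z) (by linarith)).and_eventually hpos).mono ?_
    rintro p ⟨hp, h0⟩
    refine hyz.le.trans ?_
    rw [EReal.coe_le_coe_iff, le_div_iff₀ h0]
    linarith

theorem zero_mem_clarkeSubdiff_iff {h : V → ℝ} {η : V} :
    0 ∈ clarkeSubdiff h η ↔ ∀ v : V, ∀ r : ℝ, 0 < r →
      ∃ᶠ p : V × ℝ in 𝓝 η ×ˢ 𝓝[>] (0 : ℝ), -(r * p.2) ≤ h (p.1 + p.2 • v) - h p.1 := by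
  simp only [clarkeSubdiff, mem_ofPred_eq, inner_zero_left, EReal.coe_zero, zero_le_clarkeDeriv_iff]

end VectorSpace

/-! ### Transfer of difference quotients in a normed space -/

section StrictDerivative

variable {E : Type*} [NormedAddCommGroup E] [NormedSpace ℝ E]

/-- If `G ∘ θ` is Lipschitz near `a` and `θ` is strictly differentiable at `a` with derivative the
identity, then `G` is Lipschitz near `θ a`. -/
theorem exists_lipschitzOnWith_of_comp [CompleteSpace E] {θ : E → E} {a : E} {G : E → ℝ}
    (hθ : HasStrictFDerivAt θ (ContinuousLinearEquiv.refl ℝ E : E →L[ℝ] E) a)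
    (hG : ∃ K, ∃ s ∈ 𝓝 a, LipschitzOnWith K (fun u => G (θ u)) s) :
    ∃ K, ∃ s ∈ 𝓝 (θ a), LipschitzOnWith K G s := by
  obtain ⟨K, s, hs, hK⟩ := hG
  -- Near `θ a`, `G` is `G ∘ θ` composed with the local inverse of `θ`, and that inverse is
  -- Lipschitz.
  obtain ⟨K', s', hs', hK'⟩ := hθ.to_localInverse.exists_lipschitzOnWith
  have hs2 := hθ.localInverse_tendsto hs
  refine ⟨K * K', _, inter_mem (inter_mem hs' hs2) hθ.eventually_right_inverse, ?_⟩
  have := hK.comp (hK'.mono (fun z hz => hz.1.1) : LipschitzOnWith K' _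
    (s' ∩ (hθ.localInverse θ _ a) ⁻¹' s ∩ {y | θ (hθ.localInverse θ _ a y) = y}))
    (fun z hz => hz.1.2)
  intro z hz w hw
  have h2 := this hz hw
  have hz2 : θ (hθ.localInverse θ _ a z) = z := hz.2
  have hw2 : θ (hθ.localInverse θ _ a w) = w := hw.2
  simpa only [Function.comp_apply, hz2, hw2] using h2

theorem hasStrictFDerivAt_slice {Ψ : E × E → E} {Ψ' : E × E →L[ℝ] E} {p₀ a : E}
    (hΨ : HasStrictFDerivAt Ψ Ψ' (p₀, a)) (hΨ' : ∀ u, Ψ' (0, u) = u) :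
    HasStrictFDerivAt (fun u => Ψ (p₀, u)) (ContinuousLinearEquiv.refl ℝ E : E →L[ℝ] E) a := by
  have h1 := (hasStrictFDerivAt_const (𝕜 := ℝ) p₀ a).prodMk (hasStrictFDerivAt_id (𝕜 := ℝ) a)
  refine (hΨ.comp a h1).congr_fderiv ?_
  ext u
  simp [hΨ']

/-- Transfer of approximate stationarity along a family of maps `Ψ (p, ·)`: if, for `p` near `p₀`,
the difference quotients of `G ∘ Ψ (p, ·)` near `0` in direction `v` come arbitrarily close to
`-φ' v` or exceed it, then those of `(φ + G) ∘ Ψ (p₀, ·)` come arbitrarily close to `0` or exceed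
it. -/
theorem frequently_of_frequently_family [CompleteSpace E] {Ψ : E × E → E} {Ψ' : E × E →L[ℝ] E}
    {p₀ : E} {G φ : E → ℝ} {φ' : E →L[ℝ] ℝ} {v : E}
    (hΨ : HasStrictFDerivAt Ψ Ψ' (p₀, 0)) (hΨ₀ : Ψ (p₀, 0) = p₀) (hΨ' : ∀ u, Ψ' (0, u) = u)
    (hG : ∃ K, ∃ s ∈ 𝓝 p₀, LipschitzOnWith K G s) (hφ : HasStrictFDerivAt φ φ' p₀)
    (hfreq : ∀ r : ℝ, 0 < r → ∃ᶠ P : (E × E) × ℝ in 𝓝 (p₀, (0 : E)) ×ˢ 𝓝[>] (0 : ℝ),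
      -(r * P.2) ≤ P.2 * φ' v + (G (Ψ (P.1.1, P.1.2 + P.2 • v)) - G (Ψ P.1)))
    {r : ℝ} (hr : 0 < r) :
    ∃ᶠ P : E × ℝ in 𝓝 (0 : E) ×ˢ 𝓝[>] (0 : ℝ),
      -(r * P.2) ≤ (φ (Ψ (p₀, P.1 + P.2 • v)) + G (Ψ (p₀, P.1 + P.2 • v)))
        - (φ (Ψ (p₀, P.1)) + G (Ψ (p₀, P.1))) := by
  obtain ⟨K, s, hs, hK⟩ := hG
  set θ : E → E := fun u => Ψ (p₀, u) with hθdef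
  have hθ : HasStrictFDerivAt θ (ContinuousLinearEquiv.refl ℝ E : E →L[ℝ] E) 0 :=
    hasStrictFDerivAt_slice hΨ hΨ'
  have hθ0 : θ 0 = p₀ := hΨ₀
  set inv := hθ.localInverse θ _ 0 with hinv
  have hinvt : Tendsto inv (𝓝 p₀) (𝓝 0) := by
    have := hθ.localInverse_tendsto; rwa [hθ0] at this
  have hinvr : ∀ᶠ z in 𝓝 p₀, θ (inv z) = z := by
    have := hθ.eventually_right_inverse; rwa [hθ0] at this
  set l := 𝓝 (p₀, (0 : E)) ×ˢ 𝓝[>] (0 : ℝ) with hl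
  have tt : Tendsto (fun P : (E × E) × ℝ => P.2 • v) l (𝓝 0) := by
    have : Tendsto (fun P : (E × E) × ℝ => P.2) l (𝓝 0) :=
      (tendsto_snd).mono_right nhdsWithin_le_nhds
    simpa using this.smul_const v
  have tP : Tendsto (fun P : (E × E) × ℝ => P.1) l (𝓝 (p₀, 0)) := tendsto_fst
  have tP' : Tendsto (fun P : (E × E) × ℝ => (P.1.1, P.1.2 + P.2 • v)) l (𝓝 (p₀, 0)) := by
    have h1 : Tendsto (fun P : (E × E) × ℝ => P.1.1) l (𝓝 p₀) :=
      (continuous_fst.tendsto (p₀, (0 : E))).comp tP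
    have h2 : Tendsto (fun P : (E × E) × ℝ => P.1.2) l (𝓝 0) :=
      (continuous_snd.tendsto (p₀, (0 : E))).comp tP
    simpa using h1.prodMk_nhds (h2.add tt)
  have cΨ : Tendsto Ψ (𝓝 (p₀, 0)) (𝓝 p₀) := by
    have := hΨ.continuousAt.tendsto; rwa [hΨ₀] at this
  have tz1 := cΨ.comp tP
  have tz2 := cΨ.comp tP'
  have tζ := hinvt.comp tz1
  have tζ' : Tendsto (fun P : (E × E) × ℝ => inv (Ψ P.1) + P.2 • v) l (𝓝 0) := by
    simpa using tζ.add tt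
  have tz3 : Tendsto (fun P : (E × E) × ℝ => θ (inv (Ψ P.1) + P.2 • v)) l (𝓝 p₀) := by
    have := hθ.continuousAt.tendsto; rw [hθ0] at this
    exact this.comp tζ'
  -- `κ` is the relative error in all three strict derivatives. The bracket collects the losses: `2
  -- * K` from `G`, `‖φ'‖` from the linear part of `φ`, `κ + 1` from its remainder. Imposing `κ ≤ 1`
  -- removes `κ` from the bracket.
  obtain ⟨κ, hκ0, hκ⟩ : ∃ κ : ℝ, 0 < κ ∧
      κ * ((2 * K + ‖φ'‖ + κ + 1) * ‖v‖) ≤ r / 2 ∧ κ ≤ 1 := by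
    set A := (2 * K + ‖φ'‖ + 2) * ‖v‖ with hA
    have hA0 : 0 ≤ A := by positivity
    refine ⟨min 1 (r / 2 / (A + 1)), by positivity, ?_, min_le_left _ _⟩
    set κ := min 1 (r / 2 / (A + 1)) with hκ
    have h1 : κ ≤ 1 := min_le_left _ _
    have h0 : 0 < κ := by positivity
    have h2 : κ * (A + 1) ≤ r / 2 := by
      rw [← le_div_iff₀ (by positivity)]; exact min_le_right _ _
    have h3 : (2 * K + ‖φ'‖ + κ + 1) * ‖v‖ ≤ A := by
      exact mul_le_mul_of_nonneg_right (by linarith) (norm_nonneg _)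
    nlinarith
  obtain ⟨hκr, hκ1⟩ := hκ
  have sΨ := (tP'.prodMk_nhds tP).eventually (hΨ.isLittleO.def hκ0)
  have sθ := (tζ'.prodMk_nhds tζ).eventually (hθ.isLittleO.def hκ0)
  have sφ := (tz3.prodMk_nhds tz1).eventually (hφ.isLittleO.def hκ0)
  have hpos : ∀ᶠ P in l, 0 < P.2 := tendsto_snd.eventually self_mem_nhdsWithin
  have main := (hfreq (r / 2) (by positivity)).and_eventually
    (sΨ.and (sθ.and (sφ.and (hpos.and ((tz1.eventually hinvr).and
      ((tz2.eventually hs).and (tz3.eventually hs)))))))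
  -- The witness for a triple `(p, u, t)` is the preimage of `Ψ (p, u)` under `θ`, so both
  -- increments start from the same point `z1`.
  have tend : Tendsto (fun P : (E × E) × ℝ => (inv (Ψ P.1), P.2)) l (𝓝 (0 : E) ×ˢ 𝓝[>] (0 : ℝ)) :=
    tζ.prodMk tendsto_snd
  refine tend.frequently (main.mono ?_)
  rintro ⟨⟨p, u⟩, t⟩ ⟨h1, h2, h3, h4, ht, h5, h6, h7⟩
  simp only [Function.comp_apply, ContinuousLinearEquiv.coe_coe, ContinuousLinearEquiv.coe_refl',
    id_eq, add_sub_cancel_left, Prod.mk_sub_mk, sub_self, hΨ'] at h1 h2 h3 h4 ht h5 h6 h7 ⊢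
  change -(r * t) ≤ (φ (θ (inv (Ψ (p, u)) + t • v)) + G (θ (inv (Ψ (p, u)) + t • v))) -
    (φ (θ (inv (Ψ (p, u)))) + G (θ (inv (Ψ (p, u)))))
  rw [h5] at h3 ⊢
  set z1 := Ψ (p, u)
  set z2 := Ψ (p, u + t • v)
  set z3 := θ (inv z1 + t • v)
  have hn : ‖t • v‖ = t * ‖v‖ := by rw [norm_smul, Real.norm_of_nonneg ht.le]
  have hn2 : ‖((0 : E), t • v)‖ = t * ‖v‖ := by rw [Prod.norm_mk, norm_zero, hn]; simp; positivity
  rw [hn2] at h2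
  rw [hn] at h3
  -- Both endpoints are `z1 + t • v` up to `κ * t * ‖v‖`.
  have h32 : ‖z3 - z2‖ ≤ 2 * (κ * (t * ‖v‖)) := by
    have : z3 - z2 = (z3 - z1 - t • v) - (z2 - z1 - t • v) := by abel
    rw [this]
    refine (norm_sub_le _ _).trans ?_
    linarith
  have hGl := hK.dist_le_mul z3 h7 z2 h6
  rw [dist_eq_norm, dist_eq_norm, Real.norm_eq_abs] at hGl
  have hGl2 := (abs_le.1 hGl).1
  have h31 : ‖z3 - z1‖ ≤ (κ + 1) * (t * ‖v‖) := by
    have : z3 - z1 = (z3 - z1 - t • v) + t • v := by abel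
    rw [this]
    refine (norm_add_le _ _).trans ?_
    rw [hn]; linarith
  have h8 : |φ' (z3 - z1 - t • v)| ≤ ‖φ'‖ * (κ * (t * ‖v‖)) :=
    (φ'.le_opNorm _).trans (by gcongr)
  rw [map_sub, map_smul, smul_eq_mul] at h8
  rw [Real.norm_eq_abs] at h4
  have h9 := (abs_le.1 h4).1
  have h10 := (abs_le.1 h8).1
  have h11 : κ * ‖z3 - z1‖ ≤ κ * ((κ + 1) * (t * ‖v‖)) := by gcongr
  have h12 : (K : ℝ) * ‖z3 - z2‖ ≤ K * (2 * (κ * (t * ‖v‖))) := by gcongr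
  have h13 := mul_le_mul_of_nonneg_right hκr ht.le
  nlinarith

end StrictDerivative

/-! ### The retraction and differentials in local coordinates -/

section Coordinates

variable {E : Type*} [NormedAddCommGroup E] [NormedSpace ℝ E]
  {M : Type*} [TopologicalSpace M] [ChartedSpace E M] [IsManifold 𝓘(ℝ, E) ∞ M]

/-- The tangent vector at `y` with coordinates `u` in the trivialization at `x₀`. -/
noncomputable def coordVec (x₀ y : M) : E →L[ℝ] TangentSpace 𝓘(ℝ, E) y :=
  (trivializationAt E (TangentSpace 𝓘(ℝ, E)) x₀).symmL ℝ y

/-- The coordinates, in the trivialization at `x₀`, of a tangent vector at `y`. -/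
noncomputable def vecCoord (x₀ y : M) : TangentSpace 𝓘(ℝ, E) y →L[ℝ] E :=
  (trivializationAt E (TangentSpace 𝓘(ℝ, E)) x₀).continuousLinearMapAt ℝ y

theorem coordVec_vecCoord {x₀ y : M} (hy : y ∈ (chartAt E x₀).source)
    (η : TangentSpace 𝓘(ℝ, E) y) : coordVec x₀ y (vecCoord x₀ y η) = η :=
  (trivializationAt E (TangentSpace 𝓘(ℝ, E)) x₀).symmL_continuousLinearMapAt (R := ℝ) hy η

theorem coordVec_self (x₀ : M) (u : E) : coordVec x₀ x₀ u = u := by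
  unfold coordVec
  rw [TangentBundle.symmL_trivializationAt_eq_core (mem_chart_source E x₀)]
  exact (tangentBundleCore 𝓘(ℝ, E) M).coordChange_self _ _ (mem_chart_source E x₀) u

theorem mk_coordVec_eq {x₀ y : M} (hy : y ∈ (chartAt E x₀).source) (u : E) :
    (⟨y, coordVec x₀ y u⟩ : TangentBundle 𝓘(ℝ, E) M) =
      (trivializationAt E (TangentSpace 𝓘(ℝ, E)) x₀).toOpenPartialHomeomorph.symm (y, u) := by
  unfold coordVec
  rw [Bundle.Trivialization.symmL_apply _ hy]
  exact ((trivializationAt E (TangentSpace 𝓘(ℝ, E)) x₀).mk_symm hy u)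

/-- A retraction read in the chart at `x₀` and the corresponding trivialization of the tangent
bundle. -/
noncomputable def Retraction.coordRep (R : Retraction E M) (x₀ : M) (p : E × E) : E :=
  extChartAt 𝓘(ℝ, E) x₀ (R.at ((extChartAt 𝓘(ℝ, E) x₀).symm p.1)
    (coordVec x₀ ((extChartAt 𝓘(ℝ, E) x₀).symm p.1) p.2))

theorem Retraction.at_zero (R : Retraction E M) (x : M) : R.at x 0 = x := R.map_zero x

/-- Tangent vectors with fixed coordinates depend smoothly on the base point and the coordinates. -/
theorem contMDiffAt_mk_coordVec (x₀ : M) (u : E) :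
    ContMDiffAt (𝓘(ℝ, E).prod 𝓘(ℝ, E)) 𝓘(ℝ, E).tangent ∞
      (fun p : M × E => (⟨p.1, coordVec x₀ p.1 p.2⟩ : TangentBundle 𝓘(ℝ, E) M)) (x₀, u) := by
  set e := trivializationAt E (TangentSpace 𝓘(ℝ, E)) x₀
  have hmem : ((x₀, u) : M × E) ∈ e.target := by
    rw [TangentBundle.trivializationAt_target]
    exact ⟨mem_chart_source E x₀, mem_univ _⟩
  have h := (e.contMDiffOn_symm (IB := 𝓘(ℝ, E)) (n := ∞)).contMDiffAt
    (e.open_target.mem_nhds hmem)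
  refine h.congr_of_eventuallyEq ?_
  filter_upwards [e.open_target.mem_nhds hmem] with p hp
  rw [TangentBundle.trivializationAt_target] at hp
  exact mk_coordVec_eq hp.1 p.2

theorem Retraction.coordRep_base (R : Retraction E M) (x₀ : M) :
    R.coordRep x₀ (extChartAt 𝓘(ℝ, E) x₀ x₀, 0) = extChartAt 𝓘(ℝ, E) x₀ x₀ := by
  unfold Retraction.coordRep
  rw [_root_.map_zero, R.at_zero]
  simp

theorem Retraction.contMDiffAt_at_coordVec (R : Retraction E M) (x₀ : M) :
    ContMDiffAt 𝓘(ℝ, E × E) 𝓘(ℝ, E) ∞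
      (fun p : E × E => R.at ((extChartAt 𝓘(ℝ, E) x₀).symm p.1)
        (coordVec x₀ ((extChartAt 𝓘(ℝ, E) x₀).symm p.1) p.2))
      (extChartAt 𝓘(ℝ, E) x₀ x₀, 0) := by
  have hc : ContMDiffAt 𝓘(ℝ, E) 𝓘(ℝ, E) ∞ (extChartAt 𝓘(ℝ, E) x₀).symm
      (extChartAt 𝓘(ℝ, E) x₀ x₀) :=
    (contMDiffOn_extChartAt_symm x₀).contMDiffAt (extChartAt_target_mem_nhds x₀)
  have h1 : ContMDiffAt 𝓘(ℝ, E × E) (𝓘(ℝ, E).prod 𝓘(ℝ, E)) ∞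
      (fun p : E × E => ((extChartAt 𝓘(ℝ, E) x₀).symm p.1, p.2))
      (extChartAt 𝓘(ℝ, E) x₀ x₀, (0 : E)) :=
    (ContMDiffAt.comp (extChartAt 𝓘(ℝ, E) x₀ x₀, (0 : E)) hc
      contDiff_fst.contMDiff.contMDiffAt).prodMk contDiff_snd.contMDiff.contMDiffAt
  have h2 := contMDiffAt_mk_coordVec (E := E) x₀ 0
  have h3 := ContMDiffAt.comp_of_eq h2 h1 (by simp)
  exact R.contMDiff_toFun.contMDiffAt.comp _ h3

theorem Retraction.coordRep_apply (R : Retraction E M) {x₀ y : M} (hy : y ∈ (chartAt E x₀).source)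
    (u : E) : R.coordRep x₀ (extChartAt 𝓘(ℝ, E) x₀ y, u) =
      extChartAt 𝓘(ℝ, E) x₀ (R.at y (coordVec x₀ y u)) := by
  unfold Retraction.coordRep
  dsimp only
  rw [(extChartAt 𝓘(ℝ, E) x₀).left_inv (by rwa [extChartAt_source])]

/-- The retraction maps points near `0_{x₀}` to points near `x₀`. -/
theorem Retraction.tendsto_at (R : Retraction E M) (x₀ : M) :
    Tendsto (fun p : E × E => R.at ((extChartAt 𝓘(ℝ, E) x₀).symm p.1)
      (coordVec x₀ ((extChartAt 𝓘(ℝ, E) x₀).symm p.1) p.2))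
      (𝓝 (extChartAt 𝓘(ℝ, E) x₀ x₀, 0)) (𝓝 x₀) := by
  have h := (R.contMDiffAt_at_coordVec x₀).continuousAt.tendsto
  rw [_root_.map_zero, R.at_zero] at h
  simpa using h

/-- Near `0_{x₀}`, the retraction is recovered from its coordinate representation. -/
theorem Retraction.eventually_symm_coordRep (R : Retraction E M) (x₀ : M) :
    ∀ᶠ p : E × E in 𝓝 (extChartAt 𝓘(ℝ, E) x₀ x₀, 0),
      (extChartAt 𝓘(ℝ, E) x₀).symm (R.coordRep x₀ p) =
        R.at ((extChartAt 𝓘(ℝ, E) x₀).symm p.1)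
          (coordVec x₀ ((extChartAt 𝓘(ℝ, E) x₀).symm p.1) p.2) := by
  filter_upwards [R.tendsto_at x₀ (extChartAt_source_mem_nhds (I := 𝓘(ℝ, E)) x₀)] with p hp
  exact (extChartAt 𝓘(ℝ, E) x₀).left_inv hp

theorem Retraction.contDiffAt_coordRep (R : Retraction E M) (x₀ : M) :
    ContDiffAt ℝ ∞ (R.coordRep x₀) (extChartAt 𝓘(ℝ, E) x₀ x₀, 0) := by
  rw [← contMDiffAt_iff_contDiffAt]
  refine ContMDiffAt.comp_of_eq (y := x₀) (g := extChartAt 𝓘(ℝ, E) x₀)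
    contMDiffAt_extChartAt (R.contMDiffAt_at_coordVec x₀) ?_
  rw [_root_.map_zero, R.at_zero]
  simp

theorem Retraction.hasDerivAt_ray (R : Retraction E M) (x₀ : M) (η : TangentSpace 𝓘(ℝ, E) x₀) :
    HasDerivAt (F := E) (fun t : ℝ => extChartAt 𝓘(ℝ, E) x₀ (R.at x₀ (t • η))) η 0 := by
  have h3 := (R.hasMFDerivAt_ray x₀ η).2
  have h4 : R.toFun ⟨x₀, (0 : ℝ) • η⟩ = x₀ := by
    rw [zero_smul]; exact R.map_zero x₀
  rw [writtenInExtChartAt, h4] at h3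
  simp only [modelWithCornersSelf_coe, range_id] at h3
  exact hasFDerivWithinAt_univ.1 h3

/-- The chain rule and the first-order retraction axiom differentiate the same ray. This is what
makes the coordinate form of `R_{x₀}` locally invertible at `0`. -/
theorem Retraction.fderiv_coordRep (R : Retraction E M) (x₀ : M) (u : E) :
    fderiv ℝ (R.coordRep x₀) (extChartAt 𝓘(ℝ, E) x₀ x₀, 0) (0, u) = u := by
  have hd := ((R.contDiffAt_coordRep x₀).differentiableAt (by simp)).hasFDerivAt
  have h1 : HasDerivAt (fun t : ℝ => ((extChartAt 𝓘(ℝ, E) x₀ x₀, t • u) : E × E)) (0, u) 0 := by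
    have := (hasDerivAt_const (0 : ℝ) (extChartAt 𝓘(ℝ, E) x₀ x₀)).prodMk
      ((hasDerivAt_id (0 : ℝ)).smul_const u)
    simpa using this
  have h2 : HasDerivAt (fun t : ℝ => R.coordRep x₀ (extChartAt 𝓘(ℝ, E) x₀ x₀, t • u))
      (fderiv ℝ (R.coordRep x₀) (extChartAt 𝓘(ℝ, E) x₀ x₀, 0) (0, u)) 0 := by
    refine HasFDerivAt.comp_hasDerivAt (l := R.coordRep x₀) (0 : ℝ) ?_ h1
    simpa using hd
  have h3 := R.hasDerivAt_ray x₀ (coordVec x₀ x₀ u)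
  rw [coordVec_self] at h3
  refine h2.unique (h3.congr_of_eventuallyEq (Eventually.of_forall fun t => ?_))
  dsimp only
  rw [R.coordRep_apply (mem_chart_source E x₀), map_smul, coordVec_self]

theorem Retraction.hasStrictFDerivAt_coordRep (R : Retraction E M) (x₀ : M) :
    HasStrictFDerivAt (R.coordRep x₀)
      (fderiv ℝ (R.coordRep x₀) (extChartAt 𝓘(ℝ, E) x₀ x₀, 0)) (extChartAt 𝓘(ℝ, E) x₀ x₀, 0) :=
  (R.contDiffAt_coordRep x₀).hasStrictFDerivAt (by simp)

theorem Retraction.eventually_symm_coordRep_base (R : Retraction E M) (x₀ : M) :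
    ∀ᶠ u : E in 𝓝 0, (extChartAt 𝓘(ℝ, E) x₀).symm
      (R.coordRep x₀ (extChartAt 𝓘(ℝ, E) x₀ x₀, u)) = R.at x₀ (coordVec x₀ x₀ u) := by
  have h : Tendsto (fun u : E => (extChartAt 𝓘(ℝ, E) x₀ x₀, u)) (𝓝 0)
      (𝓝 (extChartAt 𝓘(ℝ, E) x₀ x₀, 0)) := Continuous.tendsto (by fun_prop) 0
  filter_upwards [h.eventually (R.eventually_symm_coordRep x₀)] with u hu
  rwa [extChartAt_to_inv x₀] at hu

theorem contDiffAt_comp_extChartAt_symm {f : M → ℝ} (hf : ContMDiff 𝓘(ℝ, E) 𝓘(ℝ, ℝ) 1 f)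
    (x₀ : M) : ContDiffAt ℝ 1 (fun z => f ((extChartAt 𝓘(ℝ, E) x₀).symm z))
      (extChartAt 𝓘(ℝ, E) x₀ x₀) := by
  have hc : ContMDiffAt 𝓘(ℝ, E) 𝓘(ℝ, E) 1 (extChartAt 𝓘(ℝ, E) x₀).symm
      (extChartAt 𝓘(ℝ, E) x₀ x₀) :=
    ((contMDiffOn_extChartAt_symm (n := ∞) x₀).contMDiffAt
      (extChartAt_target_mem_nhds x₀)).of_le (by simp)
  exact (hf.contMDiffAt.comp _ hc).contDiffAt

theorem mfderiv_coordVec_self {f : M → ℝ} (hf : ContMDiff 𝓘(ℝ, E) 𝓘(ℝ, ℝ) 1 f)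
    (x₀ : M) (u : E) : mfderiv 𝓘(ℝ, E) 𝓘(ℝ, ℝ) f x₀ (coordVec x₀ x₀ u) =
      fderiv ℝ (fun z => f ((extChartAt 𝓘(ℝ, E) x₀).symm z)) (extChartAt 𝓘(ℝ, E) x₀ x₀) u := by
  have h2 := (hf.contMDiffAt (x := x₀)).mdifferentiableAt one_ne_zero
  rw [h2.mfderiv, modelWithCornersSelf_coe, range_id, fderivWithin_univ, coordVec_self]
  rfl

/-- The differential of a `C¹` function, at a tangent vector with fixed coordinates, depends
continuously on the base point. -/
theorem tendsto_mfderiv_coordVec {f : M → ℝ} (hf : ContMDiff 𝓘(ℝ, E) 𝓘(ℝ, ℝ) 1 f) (x₀ : M)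
    (u : E) : Tendsto (fun y => (mfderiv 𝓘(ℝ, E) 𝓘(ℝ, ℝ) f y (coordVec x₀ y u) : ℝ)) (𝓝 x₀)
      (𝓝 (fderiv ℝ (fun z => f ((extChartAt 𝓘(ℝ, E) x₀).symm z)) (extChartAt 𝓘(ℝ, E) x₀ x₀) u)) := by
  have : IsManifold 𝓘(ℝ, E) 1 M := IsManifold.of_le (n := ∞) (by simp)
  have h1 : ContinuousAt (fun y : M => (⟨y, coordVec x₀ y u⟩ : TangentBundle 𝓘(ℝ, E) M)) x₀ :=
    ContinuousAt.comp (f := fun y : M => (y, u))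
      (contMDiffAt_mk_coordVec (E := E) x₀ u).continuousAt (by fun_prop)
  have h2 := (hf.continuous_tangentMap le_rfl).continuousAt.comp h1
  have h3 := (tangentBundleModelSpaceHomeomorph 𝓘(ℝ, ℝ)).continuous.continuousAt.comp h2
  have h4 := (continuous_snd.continuousAt.comp h3).tendsto
  rw [← mfderiv_coordVec_self hf]
  exact h4

end Coordinates

/-! ### Lipschitz data and stationarity of limits -/

section Riemannian

variable {E : Type*} [NormedAddCommGroup E] [NormedSpace ℝ E] [FiniteDimensional ℝ E]
  {M : Type*} [TopologicalSpace M] [ChartedSpace E M] [IsManifold 𝓘(ℝ, E) ∞ M]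
  [Bundle.RiemannianBundle (fun x : M => TangentSpace 𝓘(ℝ, E) x)]

/-- A locally Lipschitz function is Lipschitz near `x₀` in the chart at `x₀`. -/
theorem RetractionLocallyLipschitz.exists_lipschitzOnWith {R : Retraction E M} {g : M → ℝ}
    (hg : RetractionLocallyLipschitz R g) (x₀ : M) :
    ∃ K, ∃ s ∈ 𝓝 (extChartAt 𝓘(ℝ, E) x₀ x₀),
      LipschitzOnWith K (fun z => g ((extChartAt 𝓘(ℝ, E) x₀).symm z)) s := by
  have hθ := hasStrictFDerivAt_slice (R.hasStrictFDerivAt_coordRep x₀) (R.fderiv_coordRep x₀)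
  have := FiniteDimensional.complete ℝ E
  have key := exists_lipschitzOnWith_of_comp
    (G := fun z => g ((extChartAt 𝓘(ℝ, E) x₀).symm z)) hθ ?_
  · rwa [R.coordRep_base] at key
  -- Near `0`, the chart form of `g` composed with the coordinate form of `R_{x₀}` is `g ∘ R_{x₀}`
  -- up to a linear map.
  obtain ⟨K, t, ht, hK⟩ := hg x₀ 0
  have hA := (coordVec x₀ x₀ : E →L[ℝ] TangentSpace 𝓘(ℝ, E) x₀).lipschitz
  have ht' : coordVec x₀ x₀ ⁻¹' t ∈ 𝓝 (0 : E) := by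
    refine (coordVec x₀ x₀ : E →L[ℝ] TangentSpace 𝓘(ℝ, E) x₀).continuous.continuousAt ?_
    rwa [map_zero]
  refine ⟨K * ‖(coordVec x₀ x₀ : E →L[ℝ] TangentSpace 𝓘(ℝ, E) x₀)‖₊, _,
    inter_mem ht' (R.eventually_symm_coordRep_base x₀), ?_⟩
  intro u hu w hw
  have h1 := hK.comp hA.lipschitzOnWith (fun z (hz : z ∈ coordVec x₀ x₀ ⁻¹' t) => hz) hu.1 hw.1
  have hu2 := hu.2
  have hw2 := hw.2
  rw [mem_ofPred_eq] at hu2 hw2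
  dsimp only
  rw [hu2, hw2]
  exact h1

theorem RetractionLocallyLipschitz.continuous {R : Retraction E M} {g : M → ℝ}
    (hg : RetractionLocallyLipschitz R g) : Continuous g := by
  rw [continuous_iff_continuousAt]
  intro x₀
  obtain ⟨K, s, hs, hK⟩ := hg.exists_lipschitzOnWith x₀
  have h1 := (hK.continuousOn.continuousAt hs).comp (continuousAt_extChartAt (I := 𝓘(ℝ, E)) x₀)
  refine h1.congr ?_
  filter_upwards [extChartAt_source_mem_nhds (I := 𝓘(ℝ, E)) x₀] with y hy
  simp only [Function.comp_apply, (extChartAt 𝓘(ℝ, E) x₀).left_inv hy]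

/-- Growth of the proximal objective along a segment. -/
theorem proxModel_add_sub_le (R : Retraction E M) (f g : M → ℝ) {Lt : ℝ} (hLt : 0 < Lt) (y : M)
    (ξ w : TangentSpace 𝓘(ℝ, E) y) {t : ℝ} (ht : 0 < t) :
    proxModel R f g Lt y (ξ + t • w) - proxModel R f g Lt y ξ ≤
      t * inner ℝ (grad f y) w + t * (Lt * (‖ξ‖ * ‖w‖ + t / 2 * ‖w‖ ^ 2)) +
        (g (R.at y (ξ + t • w)) - g (R.at y ξ)) := by
  unfold proxModel
  have h1 : inner ℝ (grad f y) (ξ + t • w) =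
      inner ℝ (grad f y) ξ + t * inner ℝ (grad f y) w := by
    rw [inner_add_right, inner_smul_right]
  have h2 : ‖ξ + t • w‖ ≤ ‖ξ‖ + t * ‖w‖ := by
    refine (norm_add_le _ _).trans ?_
    rw [norm_smul, Real.norm_of_nonneg ht.le]
  have h3 : ‖ξ + t • w‖ ^ 2 ≤ (‖ξ‖ + t * ‖w‖) ^ 2 := by gcongr
  have h4 : Lt / 2 * ‖ξ + t • w‖ ^ 2 ≤ Lt / 2 * (‖ξ‖ + t * ‖w‖) ^ 2 := by gcongr
  rw [h1]
  linarith

/-- Limits of stationary points `ηs k → 0` of the proximal objectives at `x k` give stationary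
points of the objective. -/
theorem isStationaryPoint_of_mapClusterPt
    [IsContMDiffRiemannianBundle 𝓘(ℝ, E) ∞ E (fun x : M => TangentSpace 𝓘(ℝ, E) x)]
    {R : Retraction E M} {f g : M → ℝ} (hf : ContMDiff 𝓘(ℝ, E) 𝓘(ℝ, ℝ) 1 f)
    (hg : RetractionLocallyLipschitz R g) {Lt : ℝ} (hLt : 0 < Lt)
    {x : ℕ → M} {ηs : ∀ k, TangentSpace 𝓘(ℝ, E) (x k)}
    (hst : ∀ k, 0 ∈ clarkeSubdiff (proxModel R f g Lt (x k)) (ηs k))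
    (hη : Tendsto (fun k => ‖ηs k‖) atTop (𝓝 0)) {xs : M} (hxs : MapClusterPt xs atTop x) :
    IsStationaryPoint R (fun y => f y + g y) xs := by
  have := FiniteDimensional.complete ℝ E
  have hRB : IsContinuousRiemannianBundle E (fun x : M => TangentSpace 𝓘(ℝ, E) x) :=
    let ⟨i, hi, hi'⟩ := ‹IsContMDiffRiemannianBundle 𝓘(ℝ, E) ∞ E
      (fun x : M => TangentSpace 𝓘(ℝ, E) x)›.exists_contMDiff
    ⟨⟨i, hi.continuous, hi'⟩⟩
  unfold IsStationaryPoint riemannianSubdiff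
  rw [zero_mem_clarkeSubdiff_iff]
  intro v r hr
  set u : E := vecCoord xs xs v with hu
  have hcu : coordVec xs xs u = v := coordVec_vecCoord (mem_chart_source E xs) v
  set c := extChartAt 𝓘(ℝ, E) xs with hc
  set φ' := fderiv ℝ (fun z => f (c.symm z)) (c xs) with hφ'
  have hφ : HasStrictFDerivAt (fun z => f (c.symm z)) φ' (c xs) :=
    (contDiffAt_comp_extChartAt_symm hf xs).hasStrictFDerivAt one_ne_zero
  have key := frequently_of_frequently_family (v := u) (R.hasStrictFDerivAt_coordRep xs)
    (R.coordRep_base xs) (R.fderiv_coordRep xs) (hg.exists_lipschitzOnWith xs) hφ ?_ hr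
  · have tend : Tendsto (fun P : E × ℝ => (coordVec xs xs P.1, P.2)) (𝓝 (0 : E) ×ˢ 𝓝[>] (0 : ℝ))
        (𝓝 (0 : TangentSpace 𝓘(ℝ, E) xs) ×ˢ 𝓝[>] (0 : ℝ)) := by
      have h0 : Tendsto (coordVec xs xs) (𝓝 (0 : E)) (𝓝 (0 : TangentSpace 𝓘(ℝ, E) xs)) := by
        have := (coordVec xs xs : E →L[ℝ] TangentSpace 𝓘(ℝ, E) xs).continuous.tendsto 0
        rwa [map_zero] at this
      exact h0.prodMap tendsto_id
    have t1 : Tendsto (fun P : E × ℝ => P.1 + P.2 • u) (𝓝 (0 : E) ×ˢ 𝓝[>] (0 : ℝ)) (𝓝 0) := by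
      have h1 : Tendsto (fun P : E × ℝ => P.2) (𝓝 (0 : E) ×ˢ 𝓝[>] (0 : ℝ)) (𝓝 0) :=
        tendsto_snd.mono_right nhdsWithin_le_nhds
      simpa using tendsto_fst.add (h1.smul_const u)
    have hb := R.eventually_symm_coordRep_base xs
    refine tend.frequently ((key.and_eventually ((tendsto_fst.eventually hb).and
      (t1.eventually hb))).mono ?_)
    rintro ⟨ζ, t⟩ ⟨h1, h2, h3⟩
    dsimp only at h1 h2 h3 ⊢
    rw [h2, h3, map_add, map_smul, hcu] at h1
    exact h1
  -- Each neighbourhood `U` needs only one point: one index `k` with `x k` near `xs` is fixed, then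
  -- Clarke stationarity at `ηs k` supplies `ξ` and `t`.
  · intro r hr
    rw [frequently_iff]
    intro U hU
    have hsymm := R.eventually_symm_coordRep xs
    have tshift : Tendsto (fun P : (E × E) × ℝ => (P.1.1, P.1.2 + P.2 • u))
        (𝓝 (c xs, (0 : E)) ×ˢ 𝓝[>] (0 : ℝ)) (𝓝 (c xs, (0 : E))) := by
      have h0 : Tendsto (fun P : (E × E) × ℝ => (P.1.1, P.1.2 + P.2 • u))
          (𝓝 ((c xs, (0 : E)), (0 : ℝ))) (𝓝 (c xs, (0 : E) + (0 : ℝ) • u)) :=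
        Continuous.tendsto (by fun_prop) _
      rw [zero_smul, add_zero, nhds_prod_eq] at h0
      exact h0.mono_left (prod_mono le_rfl nhdsWithin_le_nhds)
    have hev := (eventually_mem_set.2 hU).and
      ((tendsto_fst.eventually hsymm).and (tshift.eventually hsymm))
    obtain ⟨W, hW, T, hT, hWT⟩ := mem_prod_iff.1 hev
    rw [nhds_prod_eq] at hW
    obtain ⟨W₁, hW₁, W₂, hW₂, hWW⟩ := mem_prod_iff.1 hW
    obtain ⟨d, hd, hdW⟩ := Metric.mem_nhds_iff.1 hW₂
    -- Fibre norms vary with the base point. Bounds uniform near `xs` turn `‖ηs k‖ → 0` into small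
    -- coordinates and keep `‖w‖` bounded.
    obtain ⟨C, hC, hCy⟩ := eventually_norm_trivializationAt_lt E
      (fun x : M => TangentSpace 𝓘(ℝ, E) x) xs
    obtain ⟨C', hC', hCy'⟩ := eventually_norm_symmL_trivializationAt_lt E
      (fun x : M => TangentSpace 𝓘(ℝ, E) x) xs
    have hdf := (tendsto_mfderiv_coordVec hf xs u).eventually_lt_const
      (show φ' u < φ' u + r / 4 by linarith)
    have hW₁' := (continuousAt_extChartAt (I := 𝓘(ℝ, E)) xs).eventually hW₁
    have hsrc : ∀ᶠ y in 𝓝 xs, y ∈ (chartAt E xs).source := chart_source_mem_nhds E xs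
    have hk1 : ∀ᶠ k in atTop, C * ‖ηs k‖ < d := by
      have := hη.const_mul C
      rw [mul_zero] at this
      exact this.eventually_lt_const hd
    have hk2 : ∀ᶠ k in atTop, Lt * (‖ηs k‖ * (C' * ‖u‖)) < r / 4 := by
      have := (hη.mul_const (C' * ‖u‖)).const_mul Lt
      rw [zero_mul, mul_zero] at this
      exact this.eventually_lt_const (by positivity)
    obtain ⟨k, ⟨hCk, hCk', hdfk, hWk, hsk⟩, hk1, hk2⟩ :=
      ((hxs.frequently (hCy.and (hCy'.and (hdf.and (hW₁'.and hsrc))))).and_eventually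
        (hk1.and hk2)).exists
    set y := x k with hy
    set w := coordVec xs y u with hw
    have hwn : ‖w‖ ≤ C' * ‖u‖ :=
      ((coordVec xs y : E →L[ℝ] TangentSpace 𝓘(ℝ, E) y).le_opNorm u).trans (by gcongr; exact hCk'.le)
    have hηn : ‖vecCoord xs y (ηs k)‖ < d :=
      lt_of_le_of_lt (((vecCoord xs y : TangentSpace 𝓘(ℝ, E) y →L[ℝ] E).le_opNorm _).trans
        (by gcongr; exact hCk.le)) hk1
    -- One `r / 4` each goes to stationarity, to the variation of the differential of `f`, and to
    -- the quadratic term.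
    have hfr := zero_mem_clarkeSubdiff_iff.1 (hst k) w (r / 4) (by positivity)
    have e1 : ∀ᶠ P : TangentSpace 𝓘(ℝ, E) y × ℝ in 𝓝 (ηs k) ×ˢ 𝓝[>] (0 : ℝ),
        ‖vecCoord xs y P.1‖ < d := by
      have h0 : Tendsto (fun ξ => ‖vecCoord xs y ξ‖) (𝓝 (ηs k)) (𝓝 ‖vecCoord xs y (ηs k)‖) :=
        (vecCoord xs y).continuous.norm.tendsto _
      exact tendsto_fst.eventually (h0.eventually_lt_const hηn)
    have e2 : ∀ᶠ P : TangentSpace 𝓘(ℝ, E) y × ℝ in 𝓝 (ηs k) ×ˢ 𝓝[>] (0 : ℝ),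
        Lt * (‖P.1‖ * ‖w‖ + P.2 / 2 * ‖w‖ ^ 2) < r / 4 := by
      have h0 : Tendsto (fun P : TangentSpace 𝓘(ℝ, E) y × ℝ =>
          Lt * (‖P.1‖ * ‖w‖ + P.2 / 2 * ‖w‖ ^ 2)) (𝓝 (ηs k, (0 : ℝ)))
          (𝓝 (Lt * (‖ηs k‖ * ‖w‖ + 0 / 2 * ‖w‖ ^ 2))) := Continuous.tendsto (by fun_prop) _
      rw [nhds_prod_eq] at h0
      refine (h0.mono_left (prod_mono le_rfl nhdsWithin_le_nhds)).eventually_lt_const ?_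
      refine lt_of_le_of_lt ?_ hk2
      rw [zero_div, zero_mul, add_zero]
      gcongr
    have e3 : ∀ᶠ P : TangentSpace 𝓘(ℝ, E) y × ℝ in 𝓝 (ηs k) ×ˢ 𝓝[>] (0 : ℝ),
        P.2 ∈ T ∧ 0 < P.2 := tendsto_snd.eventually (inter_mem hT self_mem_nhdsWithin)
    obtain ⟨⟨ξ, t⟩, h1, h2, h3, h4, ht⟩ := (hfr.and_eventually (e1.and (e2.and e3))).exists
    dsimp only at h1 h2 h3 h4 ht
    have hmem : ((c y, vecCoord xs y ξ), t) ∈ W ×ˢ T :=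
      ⟨hWW ⟨hWk, hdW (mem_ball_zero_iff.2 h2)⟩, h4⟩
    obtain ⟨hPU, hs1, hs2⟩ := hWT hmem
    refine ⟨_, hPU, ?_⟩
    dsimp only at hs1 hs2 ⊢
    have hcy : c.symm (c y) = y := c.left_inv (by rwa [hc, extChartAt_source])
    rw [hs1, hs2]
    rw [hcy, map_add, map_smul, coordVec_vecCoord hsk, ← hw]
    have h5 := proxModel_add_sub_le R f g hLt y ξ w ht
    have h6 := mul_lt_mul_of_pos_left h3 ht
    have hdfk' : inner ℝ (grad f y) w < φ' u + r / 4 := by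
      rw [inner_grad]; exact hdfk
    have h7 := mul_lt_mul_of_pos_left hdfk' ht
    have h8 : 0 < r * t := by positivity
    linarith

end Riemannian

/-! ### Sufficient decrease and its consequences -/

section Descent

variable {E : Type*} [NormedAddCommGroup E] [NormedSpace ℝ E] [FiniteDimensional ℝ E]
  {M : Type*} [TopologicalSpace M] [ChartedSpace E M] [IsManifold 𝓘(ℝ, E) ∞ M]
  [Bundle.RiemannianBundle (fun x : M => TangentSpace 𝓘(ℝ, E) x)]

/-- Sufficient decrease of the objective along a run of the method. -/
theorem IsIRPGRun.sufficient_decrease {R : Retraction E M} {f g : M → ℝ} {L Lt : ℝ}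
    {q : ℝ × ℝ → ℝ} {ε : ℕ → ℝ} {x : ℕ → M} {ηhat ηstar : ∀ k, TangentSpace 𝓘(ℝ, E) (x k)}
    (hrun : IsIRPGRun R f g Lt q ε x ηhat ηstar) {N : Set M} (hxN : ∀ k, x k ∈ N)
    (hsmooth : RetractionSmoothOn R L f N) (k : ℕ) :
    f (x (k + 1)) + g (x (k + 1)) + (Lt - L) / 2 * ‖ηhat k‖ ^ 2 ≤ f (x k) + g (x k) := by
  -- With a singleton set, only the endpoint `x (k + 1)` has to lie in `N`.
  have h1 := hsmooth (x k) (hxN k) {ηhat k} (by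
    rintro _ rfl
    rw [← hrun.update k]
    exact hxN (k + 1)) (ηhat k) rfl
  have h2 := hrun.descent k
  simp only [proxModel, inner_zero_right, norm_zero, R.at_zero] at h2
  rw [← hrun.update k] at h1 h2
  linarith

end Descent

/-- If `a` decreases by at least `β * n k ^ 2` in each step and stays above `m`, then among the
first `(a 0 - m) / (β * δ ^ 2)` of the `n k` one is at most `δ`. -/
theorem exists_le_of_sufficient_decrease {a n : ℕ → ℝ} {β m : ℝ} (hβ : 0 < β)
    (ha : ∀ k, a (k + 1) + β * n k ^ 2 ≤ a k) (hm : ∀ k, m ≤ a k) {δ : ℝ} (hδ : 0 < δ) :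
    ∃ k : ℕ, (k : ℝ) ≤ (a 0 - m) / (β * δ ^ 2) ∧ n k ≤ δ := by
  by_contra! H
  have hpos : 0 < β * δ ^ 2 := by positivity
  have key : ∀ j : ℕ, a j ≤ a 0 - j * (β * δ ^ 2) := by
    intro j
    induction j with
    | zero => simp
    | succ j ih =>
      -- The induction feeds itself: the decrease so far and the lower bound `m` keep `j` in the
      -- range where `H` applies, so the decrease never stops.
      have hj : (j : ℝ) ≤ (a 0 - m) / (β * δ ^ 2) := by
        rw [le_div_iff₀ hpos]
        linarith [hm j]
      have h1 : δ ^ 2 ≤ n j ^ 2 := by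
        have := H j hj
        gcongr
      have h2 := mul_le_mul_of_nonneg_left h1 hβ.le
      push_cast
      linarith [ha j]
  obtain ⟨j, hj⟩ := exists_nat_gt ((a 0 - m) / (β * δ ^ 2))
  rw [div_lt_iff₀ hpos] at hj
  linarith [key j, hm j]

/-- Under sufficient decrease, the steps tend to zero. -/
theorem tendsto_zero_of_sufficient_decrease {a n : ℕ → ℝ} {β m : ℝ} (hβ : 0 < β)
    (ha : ∀ k, a (k + 1) + β * n k ^ 2 ≤ a k) (hm : ∀ k, m ≤ a k) :
    Tendsto n atTop (𝓝 0) := by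
  have hanti : Antitone a := antitone_nat_of_succ_le fun k => by
    have : 0 ≤ β * n k ^ 2 := by positivity
    linarith [ha k]
  have hlim := tendsto_atTop_ciInf hanti ⟨m, by rintro _ ⟨k, rfl⟩; exact hm k⟩
  have hdiff : Tendsto (fun k => (a k - a (k + 1)) / β) atTop (𝓝 0) := by
    simpa using (hlim.sub ((tendsto_add_atTop_iff_nat 1).2 hlim)).div_const β
  have hsq : Tendsto (fun k => n k ^ 2) atTop (𝓝 0) :=
    squeeze_zero (fun k => sq_nonneg _)
      (fun k => by rw [le_div_iff₀ hβ]; linarith [ha k]) hdiff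
  rw [tendsto_zero_iff_abs_tendsto_zero]
  simpa [Function.comp_def, Real.sqrt_sq_eq_abs] using hsq.sqrt

/-- A sequence decreasing along a continuous function stays above the value at any cluster point. -/
theorem le_of_antitone_of_mapClusterPt {X : Type*} [TopologicalSpace X] {F : X → ℝ}
    (hF : Continuous F) {x : ℕ → X} (ha : Antitone (fun k => F (x k))) {xs : X}
    (hxs : MapClusterPt xs atTop x) (k : ℕ) : F xs ≤ F (x k) := by
  by_contra! h
  obtain ⟨j, hj, hkj⟩ := ((hxs.frequently (hF.continuousAt.eventually_const_lt h)).and_eventually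
    (eventually_ge_atTop k)).exists
  exact absurd (ha hkj) (not_le.2 hj)

end IRPG

/-! ### The convergence theorem -/

theorem theorem3p1
    {E : Type*} [NormedAddCommGroup E] [NormedSpace ℝ E] [FiniteDimensional ℝ E]
    {M : Type*} [TopologicalSpace M] [T2Space M] [ChartedSpace E M] [IsManifold 𝓘(ℝ, E) ∞ M]
    [Bundle.RiemannianBundle (fun x : M => TangentSpace 𝓘(ℝ, E) x)]
    [IsContMDiffRiemannianBundle 𝓘(ℝ, E) ∞ E (fun x : M => TangentSpace 𝓘(ℝ, E) x)]
    (R : IRPG.Retraction E M) (f g F : M → ℝ)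
    (hF : ∀ y, F y = f y + g y)
    (hf : ContMDiff 𝓘(ℝ, E) 𝓘(ℝ, ℝ) 1 f)
    (hg : IRPG.RetractionLocallyLipschitz R g)
    (L Lt : ℝ) (q : ℝ × ℝ → ℝ) (ε : ℕ → ℝ)
    (x : ℕ → M) (ηhat ηstar : ∀ k, TangentSpace 𝓘(ℝ, E) (x k))
    (hrun : IRPG.IsIRPGRun R f g Lt q ε x ηhat ηstar)
    (hbdd : BddBelow (range F))
    (hcompact : IsCompact {y : M | F y ≤ F (x 0)})
    (N : Set M) (hN : {y : M | F y ≤ F (x 0)} ⊆ N) (hxN : ∀ k, x k ∈ N)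
    (hsmooth : IRPG.RetractionSmoothOn R L f N)
    (hL : L < Lt)
    (hq : Tendsto (fun k => q (ε k, ‖ηhat k‖)) atTop (𝓝 0)) :
    (∃ xs : M, MapClusterPt xs atTop x) ∧
    ∀ xs : M, MapClusterPt xs atTop x →
      IRPG.IsStationaryPoint R F xs ∧
      ∀ δ : ℝ, 0 < δ →
        ∃ k : ℕ, (k : ℝ) ≤ (F (x 0) - F xs) / ((Lt - L) / 2 * δ ^ 2) ∧ ‖ηhat k‖ ≤ δ := by
  obtain rfl : F = fun y => f y + g y := funext hF
  have hβ : 0 < (Lt - L) / 2 := by linarith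
  have hdec := hrun.sufficient_decrease hxN hsmooth
  have hanti : Antitone (fun k => f (x k) + g (x k)) := antitone_nat_of_succ_le fun k => by
    have : 0 ≤ (Lt - L) / 2 * ‖ηhat k‖ ^ 2 := by positivity
    linarith [hdec k]
  obtain ⟨m, hm⟩ := hbdd
  have hhat : Tendsto (fun k => ‖ηhat k‖) atTop (𝓝 0) :=
    IRPG.tendsto_zero_of_sufficient_decrease (a := fun k => f (x k) + g (x k)) hβ hdec
      (fun k => hm ⟨x k, rfl⟩)
  have hstar : Tendsto (fun k => ‖ηstar k‖) atTop (𝓝 0) := by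
    refine squeeze_zero (fun k => norm_nonneg _) (fun k => ?_) (by simpa using hhat.add hq)
    have h1 : ‖ηstar k‖ ≤ ‖ηhat k‖ + ‖ηhat k - ηstar k‖ := by
      have := norm_sub_le (ηhat k) (ηhat k - ηstar k)
      rwa [sub_sub_cancel] at this
    linarith [hrun.accuracy k]
  have hcont : Continuous (fun y => f y + g y) := hf.continuous.add hg.continuous
  constructor
  · obtain ⟨xs, -, hxs⟩ := hcompact.exists_mapClusterPt_of_frequently (l := atTop) (f := x)
      (Frequently.of_forall fun k => hanti (Nat.zero_le k))
    exact ⟨xs, hxs⟩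
  · intro xs hxs
    refine ⟨IRPG.isStationaryPoint_of_mapClusterPt hf hg hrun.Lt_pos hrun.stationary hstar hxs,
      fun δ hδ => ?_⟩
    exact IRPG.exists_le_of_sufficient_decrease (a := fun k => f (x k) + g (x k)) hβ hdec
      -- Here the lower bound is the value at `xs` instead of `m`, which gives the stated numerator.
      (IRPG.le_of_antitone_of_mapClusterPt hcont hanti hxs) hδ
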